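/- Let $X$ and $Y$ be compact Hausdorff spaces, and let $E$ be a complex locally convex space, that is, a complex vector space with a Hausdorff topology for which addition $E\times E\to E$ and scalar multiplication $\mathbb{C}\times E\to E$ are continuous and the origin $0_E$ has a neighborhood basis of convex sets. Assume $E\neq\{0_E\}$. Let $C(X,E)$ denote the complex vector space of all continuous functions $F:X\to E$, and put $\operatorname{Ran}(F)=\{F(x):x\in X\}$; similarly for $Y$. Write $1\otimes 0_E$ for the constant function with value $0_E$ (on $X$ or on $Y$). Let $T:C(X,E)\to C(Y,E)$ be a map, not assumed to be linear or continuous, such that $$\operatorname{Ran}(TF-TG)\subset\operatorname{Ran}(F-G)\qquad\text{for all }F,G\in C(X,E).$$ Then there exists a continuous map $\varphi:Y\to X$ such that $$TF=T(1\otimes 0_E)+F\circ\varphi\qquad\text{for all }F\in C(X,E).$$ In particular, if in addition $T(1\otimes 0_E)=1\otimes 0_E$, then $T$ is (complex) linear. -/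

import Mathlib

/-!
Fix `y : Y`. The functional `δ F = T F y - T 0 y` vanishes at `0` and satisfies
`δ F - δ G ∈ Ran (F - G)`; the theorem says that such a functional is evaluation at a point of `X`.

*Scalar functions.* Subtracting functions that differ only in the real or only in the imaginary part
shows `δ (u + i v) = δ₁ u + i δ₂ v` with real functionals `δ₁`, `δ₂`. The hypothesis then says that
for all `u, u', v, v'` a *single* point `x` realizes both `δ₁ u - δ₁ u' = u x - u' x` and
`δ₂ v - δ₂ v' = v x - v' x`. This coupling, which is where complex scalars are used, forces `δ₁` and
`δ₂` to be the same point evaluation (`exists_eval_of_coupled`): if `v ≥ 0` and `δ₂ v = 0`, then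
`δ₁ (u + v) = δ₁ u` for every `u`, so the nonnegative null functions are closed under addition; by
compactness they have a common zero, and `|u - δ₁ u|` is such a function for every `u`.

*Vector-valued functions.* Fix `e ≠ 0` in `E`. The scalar case applied to `f ↦ δ (f ⊗ e)` gives a
point `x₀`. If `p` is a continuous functional with `p e = 1`, comparing `F` with `(p ∘ F) ⊗ e` gives
`p (δ F) = p (F x₀)`, and such functionals separate the points of `E` by Hahn-Banach
(`exists_eval_of_sub_mem_range`).

The points `x₀` depend continuously on `y` because `f ∘ φ` is continuous for every scalar `f`, and
`X` is completely regular.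
-/

/-! ### Coupled real functionals -/

/-- Adding to `u` a function `v` with `δ₂ v = 0` does not change the value of `δ₁`: the point that
realizes the increment of `δ₁` can be taken in the zero set of `v`. -/
lemma apply_add_eq_of_coupled {X : Type*} [TopologicalSpace X] {δ₁ δ₂ : C(X, ℝ) → ℝ}
    (h : ∀ u u' v v' : C(X, ℝ), ∃ x,
      δ₁ u - δ₁ u' = u x - u' x ∧ δ₂ v - δ₂ v' = v x - v' x)
    (h₂ : δ₂ 0 = 0) {v : C(X, ℝ)} (hv : δ₂ v = 0) (u : C(X, ℝ)) :
    δ₁ (u + v) = δ₁ u := by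
  obtain ⟨x, hx, hx'⟩ := h (u + v) u v 0
  simp only [ContinuousMap.add_apply, ContinuousMap.zero_apply, hv, h₂] at hx hx'
  linarith

/-- If a single point always realizes the increments of both `δ₁` and `δ₂`, then both are evaluation
at one and the same point. -/
lemma exists_eval_of_coupled {X : Type*} [TopologicalSpace X] [CompactSpace X]
    {δ₁ δ₂ : C(X, ℝ) → ℝ}
    (h : ∀ u u' v v' : C(X, ℝ), ∃ x,
      δ₁ u - δ₁ u' = u x - u' x ∧ δ₂ v - δ₂ v' = v x - v' x)
    (h₁ : δ₁ 0 = 0) (h₂ : δ₂ 0 = 0) :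
    ∃ x, ∀ u, δ₁ u = u x ∧ δ₂ u = u x := by
  have h' : ∀ u u' v v' : C(X, ℝ), ∃ x,
      δ₂ u - δ₂ u' = u x - u' x ∧ δ₁ v - δ₁ v' = v x - v' x := fun u u' v v' ↦
    (h v v' u u').imp fun _ hx ↦ hx.symm
  have null_iff (v : C(X, ℝ)) : δ₁ v = 0 ↔ δ₂ v = 0 :=
    ⟨fun hv ↦ by simpa [h₂] using apply_add_eq_of_coupled h' h₁ hv 0,
      fun hv ↦ by simpa [h₁] using apply_add_eq_of_coupled h h₂ hv 0⟩
  let N : Set C(X, ℝ) := {v | 0 ≤ v ∧ δ₁ v = 0}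
  have add_mem {v w : C(X, ℝ)} (hv : v ∈ N) (hw : w ∈ N) : v + w ∈ N :=
    ⟨add_nonneg hv.1 hw.1, by
      rw [apply_add_eq_of_coupled h h₂ ((null_iff w).1 hw.2), hv.2]⟩
  have zero_mem : (0 : C(X, ℝ)) ∈ N := ⟨le_rfl, h₁⟩
  obtain ⟨x, hx⟩ : (⋂ v : N, {x | (v : C(X, ℝ)) x = 0}).Nonempty := by
    have : Nonempty N := ⟨⟨0, zero_mem⟩⟩
    refine IsCompact.nonempty_iInter_of_directed_nonempty_isCompact_isClosed _ ?_ ?_ ?_ ?_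
    · intro v w
      refine ⟨⟨v + w, add_mem v.2 w.2⟩, ?_, ?_⟩ <;> intro x hx
      all_goals
        have hv : 0 ≤ v.1 x := v.2.1 x
        have hw : 0 ≤ w.1 x := w.2.1 x
        simp only [Set.mem_ofPred_eq, ContinuousMap.add_apply] at hx ⊢
        linarith
    · intro v
      obtain ⟨x, hx, -⟩ := h v 0 0 0
      exact ⟨x, by simpa [h₁, v.2.2] using hx.symm⟩
    · exact fun v ↦ (isClosed_eq v.1.continuous continuous_const).isCompact
    · exact fun v ↦ isClosed_eq v.1.continuous continuous_const
  have key (v : C(X, ℝ)) (hv : v ∈ N) : v x = 0 := Set.mem_iInter.1 hx ⟨v, hv⟩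
  -- For `c = δᵢ u`, the point coupling `u` with `|u - c|` is a zero of `|u - c|`, so `|u - c| ∈ N`.
  refine ⟨x, fun u ↦ ⟨?_, ?_⟩⟩
  · have hu := key |u - ContinuousMap.const X (δ₁ u)| ⟨abs_nonneg _, by
      rw [null_iff]
      obtain ⟨z, hz, hz'⟩ := h u 0 |u - ContinuousMap.const X (δ₁ u)| 0
      simp only [h₁, h₂, sub_zero, ContinuousMap.zero_apply] at hz hz'
      rw [hz']; simp [hz]⟩
    simp only [ContinuousMap.abs_apply, ContinuousMap.sub_apply, ContinuousMap.const_apply,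
      abs_eq_zero] at hu
    linarith
  · have hu := key |u - ContinuousMap.const X (δ₂ u)| ⟨abs_nonneg _, by
      obtain ⟨z, hz, hz'⟩ := h |u - ContinuousMap.const X (δ₂ u)| 0 u 0
      simp only [h₁, h₂, sub_zero, ContinuousMap.zero_apply] at hz hz'
      rw [hz]; simp [hz']⟩
    simp only [ContinuousMap.abs_apply, ContinuousMap.sub_apply, ContinuousMap.const_apply,
      abs_eq_zero] at hu
    linarith

/-! ### Complex and vector-valued functions -/

/-- A functional on `C(X, ℂ)` vanishing at `0` whose increments `δ f - δ g` are values of `f - g` is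
a point evaluation. -/
lemma exists_eval_of_sub_mem_range_complex {X : Type*} [TopologicalSpace X] [CompactSpace X]
    {δ : C(X, ℂ) → ℂ} (h : ∀ f g : C(X, ℂ), ∃ x, δ f - δ g = f x - g x) (h₀ : δ 0 = 0) :
    ∃ x, ∀ f, δ f = f x := by
  let mk (u v : C(X, ℝ)) : C(X, ℂ) :=
    ⟨fun x ↦ u x + v x * Complex.I, by fun_prop⟩
  have mk_apply (u v : C(X, ℝ)) (x : X) : mk u v x = u x + v x * Complex.I := rfl
  have mk_zero : mk 0 0 = 0 := by ext x; simp [mk_apply]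
  have re_eq (u v : C(X, ℝ)) : (δ (mk u v)).re = (δ (mk u 0)).re := by
    obtain ⟨x, hx⟩ := h (mk u v) (mk u 0)
    simpa [mk_apply, sub_eq_zero] using congrArg Complex.re hx
  have im_eq (u v : C(X, ℝ)) : (δ (mk u v)).im = (δ (mk 0 v)).im := by
    obtain ⟨x, hx⟩ := h (mk u v) (mk 0 v)
    simpa [mk_apply, sub_eq_zero] using congrArg Complex.im hx
  obtain ⟨x, hx⟩ := exists_eval_of_coupled
    (δ₁ := fun u ↦ (δ (mk u 0)).re) (δ₂ := fun v ↦ (δ (mk 0 v)).im)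
    (fun u u' v v' ↦ by
      obtain ⟨x, hx⟩ := h (mk u v) (mk u' v')
      refine ⟨x, ?_, ?_⟩
      · simpa [mk_apply, re_eq u v, re_eq u' v'] using congrArg Complex.re hx
      · simpa [mk_apply, im_eq u v, im_eq u' v'] using congrArg Complex.im hx)
    (by simp [mk_zero, h₀]) (by simp [mk_zero, h₀])
  refine ⟨x, fun f ↦ ?_⟩
  let u : C(X, ℝ) := ⟨fun x ↦ (f x).re, by fun_prop⟩
  let v : C(X, ℝ) := ⟨fun x ↦ (f x).im, by fun_prop⟩
  have hf : f = mk u v := by ext x; exact (Complex.re_add_im (f x)).symm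
  apply Complex.ext
  · rw [hf, re_eq, (hx u).1]; simp [mk_apply]
  · rw [hf, im_eq, (hx v).2]; simp [mk_apply]

/-- Hahn-Banach for complex locally convex spaces. -/
lemma separatingDual_complex {E : Type*} [AddCommGroup E] [Module ℂ E] [TopologicalSpace E]
    [T2Space E] [IsTopologicalAddGroup E] [ContinuousSMul ℂ E] [LocallyConvexSpace ℝ E] :
    SeparatingDual ℂ E :=
  have : ContinuousSMul ℝ E := IsScalarTower.continuousSMul ℂ
  ⟨fun x hx ↦ by
    obtain ⟨p, hp⟩ := RCLike.geometric_hahn_banach_point_point (𝕜 := ℂ) hx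
    exact ⟨p, fun h ↦ by simp [h] at hp⟩⟩

/-- A functional on `C(X, E)` vanishing at `0` whose increments `δ F - δ G` are values of `F - G` is
a point evaluation. -/
lemma exists_eval_of_sub_mem_range {X E : Type*} [TopologicalSpace X] [CompactSpace X]
    [AddCommGroup E] [Module ℂ E] [TopologicalSpace E] [IsTopologicalAddGroup E]
    [ContinuousSMul ℂ E] [SeparatingDual ℂ E] [Nontrivial E]
    {δ : C(X, E) → E} (h : ∀ F G : C(X, E), ∃ x, δ F - δ G = F x - G x) (h₀ : δ 0 = 0) :
    ∃ x, ∀ F, δ F = F x := by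
  obtain ⟨e, he⟩ := exists_ne (0 : E)
  let ten (f : C(X, ℂ)) : C(X, E) := ⟨fun x ↦ f x • e, by fun_prop⟩
  have ten_apply (f : C(X, ℂ)) (x : X) : ten f x = f x • e := rfl
  have ten_zero : ten 0 = 0 := by ext x; simp [ten_apply]
  have smul_eq {p : E →L[ℂ] ℂ} (hp : p e = 1) (f : C(X, ℂ)) : δ (ten f) = p (δ (ten f)) • e := by
    obtain ⟨x, hx⟩ := h (ten f) 0
    have hx' : δ (ten f) = f x • e := by simpa [h₀, ten_apply] using hx
    rw [hx']; simp [hp]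
  obtain ⟨q, hq⟩ := SeparatingDual.exists_eq_one (R := ℂ) he
  obtain ⟨x₀, hx₀⟩ := exists_eval_of_sub_mem_range_complex (δ := fun f ↦ q (δ (ten f)))
    (fun f g ↦ by
      obtain ⟨x, hx⟩ := h (ten f) (ten g)
      exact ⟨x, by simpa [ten_apply, hq] using congrArg q hx⟩)
    (by simp [ten_zero, h₀])
  have ten_eq (f : C(X, ℂ)) : δ (ten f) = f x₀ • e := by rw [smul_eq hq f, hx₀]
  have apply_eq {p : E →L[ℂ] ℂ} (hp : p e = 1) (F : C(X, E)) : p (δ F) = p (F x₀) := by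
    -- `p` annihilates every value of `F - (p ∘ F) ⊗ e`.
    obtain ⟨x, hx⟩ := h F (ten ⟨fun x ↦ p (F x), by fun_prop⟩)
    simpa [ten_eq, ten_apply, hp, sub_eq_zero] using congrArg p hx
  refine ⟨x₀, fun F ↦ by_contra fun hF ↦ ?_⟩
  obtain ⟨p, hp, hp'⟩ :=
    SeparatingDual.exists_eq_one_ne_zero_of_ne_zero_pair (R := ℂ) he (sub_ne_zero.2 hF)
  exact hp' (by rw [map_sub, apply_eq hp, sub_self])

/-! ### Continuity and conclusion -/

/-- A map into a completely regular space is continuous as soon as its compositions with continuous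
real functions are. -/
lemma continuous_of_forall_continuous_comp {X Y : Type*} [TopologicalSpace X]
    [CompletelyRegularSpace X] [TopologicalSpace Y] {φ : Y → X}
    (h : ∀ f : C(X, ℝ), Continuous fun y ↦ f (φ y)) : Continuous φ := by
  refine continuous_iff_continuousAt.2 fun y U hU ↦ ?_
  obtain ⟨V, hVU, hV, hyV⟩ := mem_nhds_iff.1 hU
  obtain ⟨f, hf, hf₀, hf₁⟩ := CompletelyRegularSpace.completely_regular (φ y) Vᶜ
    hV.isClosed_compl (by simpa using hyV)
  let g : C(X, ℝ) := ⟨fun x ↦ f x, by fun_prop⟩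
  have hg : ∀ᶠ z in nhds y, g (φ z) < 1 :=
    (h g).continuousAt.eventually_lt_const (by simp [g, hf₀])
  refine Filter.mem_map.2 ?_
  filter_upwards [hg] with z hz
  by_contra hzU
  have : f (φ z) = 1 := hf₁ (fun hzV ↦ hzU (hVU hzV))
  simp [g, this] at hz

theorem theorem1p1 {X Y E : Type*}
    [TopologicalSpace X] [CompactSpace X] [T2Space X]
    [TopologicalSpace Y] [CompactSpace Y] [T2Space Y]
    [AddCommGroup E] [Module ℂ E] [TopologicalSpace E] [T2Space E]
    [IsTopologicalAddGroup E] [ContinuousSMul ℂ E] [LocallyConvexSpace ℝ E] [Nontrivial E]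
    (T : C(X, E) → C(Y, E))
    (hT : ∀ F G : C(X, E), Set.range (T F - T G) ⊆ Set.range (F - G)) :
    (∃ φ : C(Y, X), ∀ F : C(X, E),
      T F = T (ContinuousMap.const X (0 : E)) + F.comp φ) ∧
    (T (ContinuousMap.const X (0 : E)) = ContinuousMap.const Y (0 : E) →
      IsLinearMap ℂ T) := by
  have : SeparatingDual ℂ E := separatingDual_complex
  have main : ∃ φ : C(Y, X), ∀ F : C(X, E),
      T F = T (ContinuousMap.const X (0 : E)) + F.comp φ := by
    have eval (y : Y) : ∃ x, ∀ F : C(X, E), T F y - T 0 y = F x :=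
      exists_eval_of_sub_mem_range (δ := fun F ↦ T F y - T 0 y)
        (fun F G ↦ by
          obtain ⟨x, hx⟩ := hT F G ⟨y, rfl⟩
          exact ⟨x, by simpa using hx.symm⟩)
        (sub_self _)
    choose φ hφ using eval
    obtain ⟨e, he⟩ := exists_ne (0 : E)
    obtain ⟨p, hp⟩ := SeparatingDual.exists_eq_one (R := ℂ) he
    have hφc : Continuous φ := continuous_of_forall_continuous_comp fun f ↦ by
      let F : C(X, E) := ⟨fun x ↦ (f x : ℂ) • e, by fun_prop⟩
      have hF (y : Y) : f (φ y) = (p (T F y - T 0 y)).re := by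
        rw [hφ y F]; simp [F, hp]
      simp only [hF]
      fun_prop
    refine ⟨⟨φ, hφc⟩, fun F ↦ ?_⟩
    ext y
    exact sub_eq_iff_eq_add'.1 (hφ y F)
  refine ⟨main, fun h₀ ↦ ?_⟩
  obtain ⟨φ, hφ⟩ := main
  have hT' (F : C(X, E)) (y : Y) : T F y = F (φ y) := by
    rw [hφ F, h₀]; simp
  exact ⟨fun F G ↦ by ext y; simp [hT'], fun c F ↦ by ext y; simp [hT']⟩
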